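/- For every uncountable cardinal number $\kappa$ there is a ${\sf T}_0$ (hence Hausdorff) topological group $G$ of cardinality $\kappa$ that is a Lindelöf space and a $P$-space (every $G_\delta$ subset of $G$ is open), such that player TWO has a winning strategy in the game $\mathsf{G}_1(\Omega,\Gamma)$ on $G$. Here an open cover $\mathcal{U}$ of $G$ is an $\omega$-cover if $G\notin\mathcal{U}$ and every finite $F\subseteq G$ is contained in some $U\in\mathcal{U}$; it is a $\gamma$-cover if it is infinite and each of its infinite subfamilies still covers $G$. $\Omega$ and $\Gamma$ denote the families of all open $\omega$-covers and of all open $\gamma$-covers of $G$. In $\mathsf{G}_1(\Omega,\Gamma)$, played in innings $n<\omega$, in inning $n$ ONE chooses $O_n\in\Omega$ and then TWO chooses $T_n\in O_n$; TWO wins the play if $\{T_n:n<\omega\}\in\Gamma$, and otherwise ONE wins. A strategy for TWO assigns to every finite sequence $(O_0,\dots,O_n)$ of moves of ONE a response $T_n\in O_n$; it is winning if TWO wins every play in which TWO follows it. -/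

import Mathlib

/-- A `P`-space: every `Gδ` set is open. -/
def IsPSpace (X : Type*) [TopologicalSpace X] : Prop :=
  ∀ s : Set X, IsGδ s → IsOpen s

/-- A family of subsets of `X` is an open cover of `X` if its members are open and their union
is `X`. -/
def IsCoverByOpens {X : Type*} [TopologicalSpace X] (U : Set (Set X)) : Prop :=
  (∀ s ∈ U, IsOpen s) ∧ ⋃₀ U = Set.univ

/-- The family `Ω` of all open `ω`-covers of `X`: open covers that do not contain `X` itself,
such that every finite subset of `X` is contained in a member. -/
def OmegaCovers (X : Type*) [TopologicalSpace X] : Set (Set (Set X)) :=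
  {U | IsCoverByOpens U ∧ Set.univ ∉ U ∧ ∀ F : Set X, F.Finite → ∃ s ∈ U, F ⊆ s}

/-- The family `Γ` of all open `γ`-covers of `X`: infinite open covers such that every infinite
subfamily is still a cover. -/
def GammaCovers (X : Type*) [TopologicalSpace X] : Set (Set (Set X)) :=
  {U | IsCoverByOpens U ∧ U.Infinite ∧ ∀ V ⊆ U, V.Infinite → ⋃₀ V = Set.univ}

/-- `σ` is a (perfect information) strategy for TWO in the game `G₁(A, B)`: to every finite
sequence `(O 0, …, O n)` of members of `A` played by ONE it assigns a member of `O n`.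
(The values of `σ` at sequences that are not legal for ONE are irrelevant.) -/
def IsStrategyTwo {α : Type*} (A : Set (Set α))
    (σ : (n : ℕ) → (Fin (n + 1) → Set α) → α) : Prop :=
  ∀ (n : ℕ) (O : Fin (n + 1) → Set α), (∀ i, O i ∈ A) → σ n O ∈ O (Fin.last n)

/-- TWO has a winning strategy in the game `G₁(A, B)` of length `ω`: in inning `n` ONE chooses
`O n ∈ A`, then TWO chooses `T n ∈ O n`, and TWO wins the play if `{T n : n < ω} ∈ B`. -/
def TwoHasWinningStrategyG1 {α : Type*} (A B : Set (Set α)) : Prop :=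
  ∃ σ : (n : ℕ) → (Fin (n + 1) → Set α) → α, IsStrategyTwo A σ ∧
    ∀ O : ℕ → Set α, (∀ n, O n ∈ A) →
      Set.range (fun n : ℕ => σ n (fun i : Fin (n + 1) => O i)) ∈ B

universe u

/-! Take the finitely supported functions `α →₀ ZMod 2`, with agreement on countable sets as basic
neighbourhoods. Lindelöfness and TWO's strategy both rest on truncation: if a countable `A` contains
the coordinates that decide membership in the relevant open sets, then `x` lies in such a set
because its restriction to `A` does. That restriction has finite support, so a finite stage of the
construction of `A` captures it. -/

namespace Finsupp

variable {α M : Type*}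

/-- The `Gδ`-topology on finitely supported functions: a set is open if with every `x` it contains
all functions agreeing with `x` on some countable set. -/
@[reducible]
def countableAgreementTopology (α M : Type*) [Zero M] : TopologicalSpace (α →₀ M) where
  IsOpen s := ∀ x ∈ s, ∃ A : Set α, A.Countable ∧ ∀ y : α →₀ M, (∀ a ∈ A, y a = x a) → y ∈ s
  isOpen_univ _ _ := ⟨∅, Set.countable_empty, fun _ _ => trivial⟩
  isOpen_inter s t hs ht x hx := by
    obtain ⟨A, hA, hAs⟩ := hs x hx.1
    obtain ⟨B, hB, hBt⟩ := ht x hx.2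
    exact ⟨A ∪ B, hA.union hB, fun y hy =>
      ⟨hAs y fun a ha => hy a (Or.inl ha), hBt y fun a ha => hy a (Or.inr ha)⟩⟩
  isOpen_sUnion S hS x := by
    rintro ⟨s, hs, hx⟩
    obtain ⟨A, hA, hAs⟩ := hS s hs x hx
    exact ⟨A, hA, fun y hy => ⟨s, hs, hAs y hy⟩⟩

attribute [local instance] countableAgreementTopology

theorem isOpen_setOf_agreement [Zero M] {A : Set α} (hA : A.Countable) (x : α →₀ M) :
    IsOpen {y : α →₀ M | ∀ a ∈ A, y a = x a} := fun _ hy =>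
  ⟨A, hA, fun _ hz a ha => (hz a ha).trans (hy a ha)⟩

theorem mem_nhds_iff_countable_agreement [Zero M] {s : Set (α →₀ M)} {x : α →₀ M} :
    s ∈ nhds x ↔ ∃ A : Set α, A.Countable ∧ ∀ y : α →₀ M, (∀ a ∈ A, y a = x a) → y ∈ s := by
  rw [mem_nhds_iff]
  constructor
  · rintro ⟨t, hts, ht, hx⟩
    obtain ⟨A, hA, h⟩ := ht x hx
    exact ⟨A, hA, fun y hy => hts (h y hy)⟩
  · rintro ⟨A, hA, h⟩
    exact ⟨_, h, isOpen_setOf_agreement hA x, fun _ _ => rfl⟩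

theorem isTopologicalAddGroup_countableAgreement [AddCommGroup M] :
    IsTopologicalAddGroup (α →₀ M) where
  continuous_add := continuous_iff_continuousAt.2 fun p s hs => by
    obtain ⟨A, hA, h⟩ := mem_nhds_iff_countable_agreement.1 hs
    rw [Filter.mem_map, nhds_prod_eq]
    refine Filter.mem_of_superset (Filter.prod_mem_prod
      ((isOpen_setOf_agreement hA p.1).mem_nhds fun _ _ => rfl)
      ((isOpen_setOf_agreement hA p.2).mem_nhds fun _ _ => rfl)) ?_
    rintro ⟨y, z⟩ ⟨hy, hz⟩
    exact h _ fun a ha => congrArg₂ (· + ·) (hy a ha) (hz a ha)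
  continuous_neg := continuous_iff_continuousAt.2 fun x s hs => by
    obtain ⟨A, hA, h⟩ := mem_nhds_iff_countable_agreement.1 hs
    refine Filter.mem_map.2 <| Filter.mem_of_superset
      ((isOpen_setOf_agreement hA x).mem_nhds fun _ _ => rfl) fun y hy => ?_
    exact h _ fun a ha => congrArg Neg.neg (hy a ha)

theorem t0Space_countableAgreement [Zero M] : T0Space (α →₀ M) where
  t0 x y hxy := by
    ext a
    have h := (hxy.mem_open_iff (isOpen_setOf_agreement (Set.countable_singleton a) x)).1
      fun _ _ => rfl
    exact (h a rfl).symm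

theorem isPSpace_countableAgreement [Zero M] : IsPSpace (α →₀ M) := by
  rintro s ⟨T, hT, hTc, rfl⟩ x hx
  choose! A hA h using fun t ht => hT t ht x (hx t ht)
  exact ⟨⋃ t ∈ T, A t, hTc.biUnion hA, fun y hy t ht =>
    h t ht y fun a ha => hy a (Set.mem_biUnion ht ha)⟩

theorem countable_setOf_support_subset [AddCommMonoid M] [Countable M] {A : Set α}
    (hA : A.Countable) : {x : α →₀ M | (x.support : Set α) ⊆ A}.Countable := by
  have := hA.to_subtype
  exact Set.countable_coe_iff.1 (restrictSupportEquiv A M).injective.countable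

theorem finite_setOf_support_subset [Zero M] [Finite M] (S : Finset α) :
    {x : α →₀ M | x.support ⊆ S}.Finite := by
  classical
  have := Fintype.ofFinite M
  exact (S.finsupp fun _ => Finset.univ).finite_toSet.subset fun x hx => by
    simpa [Finset.mem_finsupp_iff] using hx

theorem lindelofSpace_countableAgreement [AddCommMonoid M] [Countable M] :
    LindelofSpace (α →₀ M) := by
  classical
  refine ⟨isLindelof_of_countable_subcover fun {ι} U hU hcov => ?_⟩
  choose i hi using fun x => Set.mem_iUnion.1 (hcov (Set.mem_univ x))
  choose B hB h using fun x => hU (i x) x (hi x)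
  -- Closing off: each stage adds the coordinates `B x` of every `x` supported in the previous one.
  let A : ℕ → Set α := fun n => n.rec ∅ fun _ A =>
    A ∪ ⋃ x ∈ {x : α →₀ M | (x.support : Set α) ⊆ A}, B x
  have hA : ∀ n, (A n).Countable := fun n => by
    induction n with
    | zero => exact Set.countable_empty
    | succ n ih => exact ih.union ((countable_setOf_support_subset ih).biUnion fun x _ => hB x)
  have hmono : Monotone A := monotone_nat_of_le_succ fun n => Set.subset_union_left
  refine ⟨i '' {x | (x.support : Set α) ⊆ ⋃ n, A n},
    (countable_setOf_support_subset (Set.countable_iUnion hA)).image i, fun x _ => ?_⟩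
  let z := x.filter (· ∈ ⋃ n, A n)
  have hz : (z.support : Set α) ⊆ ⋃ n, A n := fun a ha => by
    simp only [z, support_filter, Finset.coe_filter] at ha
    exact ha.2
  obtain ⟨n, hn⟩ := hmono.directed_le.exists_mem_subset_of_finset_subset_biUnion hz
  refine Set.mem_biUnion (Set.mem_image_of_mem i hz) (h z x fun a ha => ?_)
  exact (filter_apply_pos _ _ (Set.mem_iUnion.2 ⟨n + 1, Or.inr (Set.mem_biUnion hn ha)⟩)).symm

end Finsupp

/-- A sequence of proper open sets
such that every point lies in all but finitely many of them is a `γ`-cover. -/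
theorem range_mem_gammaCovers {X : Type*} [TopologicalSpace X] {T : ℕ → Set X}
    (hopen : ∀ n, IsOpen (T n)) (hne : ∀ n, T n ≠ Set.univ)
    (hT : ∀ x, ∀ᶠ n in Filter.atTop, x ∈ T n) : Set.range T ∈ GammaCovers X := by
  have key : ∀ V ⊆ Set.range T, V.Infinite → ⋃₀ V = Set.univ := fun V hV hinf => by
    refine Set.eq_univ_of_forall fun x => ?_
    obtain ⟨N, hN⟩ := Filter.eventually_atTop.1 (hT x)
    obtain ⟨s, hs, hsN⟩ := hinf.exists_notMem_finite ((Set.finite_lt_nat N).image T)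
    obtain ⟨n, rfl⟩ := hV hs
    exact ⟨T n, hs, hN n (not_lt.1 fun hn => hsN ⟨n, hn, rfl⟩)⟩
  have hinf : (Set.range T).Infinite := fun hfin => by
    have := hfin.to_subtype
    -- With finite range, some value recurs infinitely often, hence contains every point,
    -- contradicting properness.
    obtain ⟨⟨s, hs⟩, hfib⟩ := Finite.exists_infinite_fiber (Set.rangeFactorization T)
    obtain ⟨n, rfl⟩ := hs
    refine hne n (Set.eq_univ_of_forall fun x => ?_)
    obtain ⟨N, hN⟩ := Filter.eventually_atTop.1 (hT x)
    obtain ⟨m, hm, hNm⟩ := (Set.infinite_coe_iff.1 hfib).exists_gt N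
    have hmn : T m = T n := congrArg Subtype.val (Set.mem_singleton_iff.1 hm)
    exact hmn ▸ hN m hNm.le
  exact ⟨⟨Set.forall_mem_range.2 hopen, key _ subset_rfl hinf⟩, hinf, key⟩

/-- TWO wins `G₁(A, B)` if there is a rule `r` answering each move of ONE, given a finite list
recording the earlier innings, which wins every play in which it is followed. -/
theorem twoHasWinningStrategyG1_of_recording {α β : Type*} {A B : Set (Set α)}
    (r : Set α → List β → α × β) (hr : ∀ O ∈ A, ∀ L, (r O L).1 ∈ O)
    (hwin : ∀ (O : ℕ → Set α) (L : ℕ → List β), (∀ n, O n ∈ A) → L 0 = [] →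
      (∀ n, L (n + 1) = (r (O n) (L n)).2 :: L n) →
      Set.range (fun n => (r (O n) (L n)).1) ∈ B) :
    TwoHasWinningStrategyG1 A B := by
  let record : (ℕ → Set α) → ℕ → List β := fun O n =>
    n.rec [] fun n L => (r (O n) L).2 :: L
  have hcongr : ∀ (O O' : ℕ → Set α) (n : ℕ), (∀ k < n, O k = O' k) → record O n = record O' n := by
    intro O O' n
    induction n with
    | zero => exact fun _ => rfl
    | succ n ih =>
      intro h
      change (r (O n) (record O n)).2 :: record O n = (r (O' n) (record O' n)).2 :: record O' n
      rw [ih fun k hk => h k (hk.trans n.lt_succ_self), h n n.lt_succ_self]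
  -- `Fin.ofNat` wraps around, which is harmless: the record at `n` reads only moves `k < n`.
  refine ⟨fun n O => (r (O (Fin.last n)) (record (fun k => O (Fin.ofNat (n + 1) k)) n)).1,
    fun n O hO => hr _ (hO _) _, fun O hO => ?_⟩
  convert hwin O (record O) hO rfl fun n => rfl using 4 with n
  refine congrArg (r (O n)) (hcongr _ _ n fun k hk => congrArg O ?_)
  exact Nat.mod_eq_of_lt (hk.trans n.lt_succ_self)

namespace Finsupp

variable {α M : Type*}

attribute [local instance] countableAgreementTopology

/-- Since `M` is finite, only finitely many functions live on `S`, so one member of the cover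
contains them all; countably many coordinates, enumerated by `p.2`, witness its openness at each. -/
theorem exists_mem_omegaCover_agreement [Nonempty α] [Zero M] [Finite M]
    {O : Set (Set (α →₀ M))} (hO : O ∈ OmegaCovers (α →₀ M)) (S : Finset α) :
    ∃ p : Set (α →₀ M) × (ℕ → α), p.1 ∈ O ∧
      ∀ x y : α →₀ M, x.support ⊆ S → (∀ i, y (p.2 i) = x (p.2 i)) → y ∈ p.1 := by
  obtain ⟨⟨hopen, -⟩, -, hfin⟩ := hO
  have hS := finite_setOf_support_subset (M := M) S
  obtain ⟨U, hU, hSU⟩ := hfin _ hS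
  choose! A hA h using fun x hx => hopen U hU x (hSU hx)
  obtain ⟨a⟩ := ‹Nonempty α›
  -- Inserting `a` keeps the set nonempty, so that it can be enumerated.
  obtain ⟨b, hb⟩ := ((hS.countable.biUnion hA).insert a).exists_eq_range ⟨a, Or.inl rfl⟩
  refine ⟨⟨U, b⟩, hU, fun x y hx hy => h x hx y fun c hc => ?_⟩
  obtain ⟨i, rfl⟩ := hb.subset (Or.inr (Set.mem_biUnion (show x ∈ _ from hx) hc))
  exact hy i

theorem twoHasWinningStrategyG1_countableAgreement [Nonempty α] [Zero M] [Finite M] :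
    TwoHasWinningStrategyG1 (OmegaCovers (α →₀ M)) (GammaCovers (α →₀ M)) := by
  classical
  -- Bookkeeping: in inning `n`, take the first `n` terms of each of the `n` recorded enumerations.
  -- Every recorded coordinate eventually enters `S` and stays.
  let S : List (ℕ → α) → Finset α := fun L =>
    L.toFinset.biUnion fun b => (Finset.range L.length).image b
  choose! r hrO hr using
    fun (O : Set (Set (α →₀ M))) (hO : O ∈ OmegaCovers (α →₀ M)) (L : List (ℕ → α)) =>
      exists_mem_omegaCover_agreement hO (S L)
  refine twoHasWinningStrategyG1_of_recording r hrO fun O L hO hL0 hL => ?_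
  have hmem := fun n => hrO (O n) (hO n) (L n)
  refine range_mem_gammaCovers (fun n => (hO n).1.1 _ (hmem n))
    (fun n h => (hO n).2.1 (h ▸ hmem n)) fun x => ?_
  have hlen : ∀ n, (L n).length = n := fun n => by
    induction n with
    | zero => rw [hL0]; rfl
    | succ n ih => rw [hL, List.length_cons, ih]
  have hrec : ∀ n m, n < m → (r (O n) (L n)).2 ∈ L m := fun n m hnm => by
    induction m, hnm using Nat.le_induction with
    | base => rw [hL]; exact List.mem_cons_self
    | succ m _ ih => rw [hL]; exact List.mem_cons_of_mem _ ih
  let A : Set α := {a | ∃ n i, (r (O n) (L n)).2 i = a}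
  let z := x.filter (· ∈ A)
  have hev : ∀ᶠ n in Filter.atTop, ∀ a ∈ z.support, a ∈ S (L n) := by
    refine (Filter.eventually_all_finset _).2 fun a ha => ?_
    have ha : a ∈ A := by
      simp only [z, support_filter, Finset.mem_filter] at ha
      exact ha.2
    obtain ⟨k, i, rfl⟩ := ha
    filter_upwards [Filter.eventually_gt_atTop k, Filter.eventually_gt_atTop i] with n hk hi
    refine Finset.mem_biUnion.2 ⟨_, List.mem_toFinset.2 (hrec k n hk), Finset.mem_image_of_mem _ ?_⟩
    rwa [hlen, Finset.mem_range]
  filter_upwards [hev] with n hn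
  exact hr (O n) (hO n) (L n) z x hn fun i => (filter_apply_pos _ _ ⟨n, i, rfl⟩).symm

end Finsupp

theorem corollary10 (κ : Cardinal.{u}) (hκ : Cardinal.aleph0 < κ) :
    ∃ (G : Type u) (_ : Group G) (_ : TopologicalSpace G),
      IsTopologicalGroup G ∧ T0Space G ∧ LindelofSpace G ∧ IsPSpace G ∧
      Cardinal.mk G = κ ∧
      TwoHasWinningStrategyG1 (OmegaCovers G) (GammaCovers G) := by
  induction κ using Cardinal.inductionOn with | mk α
  have hinf : Infinite α := Cardinal.infinite_iff.2 hκ.le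
  let := Finsupp.countableAgreementTopology α (ZMod 2)
  have : IsTopologicalAddGroup (α →₀ ZMod 2) := Finsupp.isTopologicalAddGroup_countableAgreement
  have hcard : Cardinal.mk (α →₀ ZMod 2) = Cardinal.mk α := by
    rw [Cardinal.mk_finsupp_lift_of_infinite, Cardinal.lift_uzero,
      max_eq_left ((Cardinal.lift_le_aleph0.2 Cardinal.mk_le_aleph0).trans hκ.le)]
  exact ⟨Multiplicative (α →₀ ZMod 2), inferInstance, inferInstance, inferInstance,
    Finsupp.t0Space_countableAgreement (α := α) (M := ZMod 2),
    Finsupp.lindelofSpace_countableAgreement (α := α) (M := ZMod 2),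
    Finsupp.isPSpace_countableAgreement (α := α) (M := ZMod 2), hcard,
    Finsupp.twoHasWinningStrategyG1_countableAgreement (α := α) (M := ZMod 2)⟩
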